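/- Let $r:\mathbb{R}^m\to\mathbb{R}\cup\{\infty\}$ be lower semicontinuous and convex, let $\bar x\in\operatorname{dom} r$ and $\bar u\in\partial r(\bar x)$. For $\sigma>0$ write $\operatorname{Prox}_{\sigma r}(x)=\operatorname{argmin}_{u}\{r(u)+\frac{1}{2\sigma}\|u-x\|^2\}$, let $r^*(x)=\sup_{u\in\operatorname{dom}r}\{\langle x,u\rangle-r(u)\}$ be the Fenchel conjugate of $r$, and let $A^\dagger$ be the Moore–Penrose inverse of a matrix $A$. For a Lipschitz mapping $S:\mathbb{R}^m\to\mathbb{R}^m$, let $\overline\nabla S(x)$ be the set of all limits of Jacobian matrices $S'(x^k)$ along sequences $x^k\to x$ of points of differentiability of $S$, let $JS(x)=\operatorname{conv}\overline\nabla S(x)$ be the Clarke generalized Jacobian, and let $D^*S(x)$ be the limiting coderivative, i.e. $z\in D^*S(x)(w)$ if and only if $(z,-w)$ belongs to the limiting (Mordukhovich) normal cone to $\operatorname{gph}S$ at $(x,S(x))$. Put $\mathcal J:=J\operatorname{Prox}_r(\bar x+\bar u)$ and $R:=\bigcup_{W\in\mathcal J}\operatorname{rge}W$. Suppose that $\overline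 W\in\overline\nabla\operatorname{Prox}_r(\bar x+\bar u)$ satisfies $R=\operatorname{rge}\overline W$ and that every $y\in R$ can be written as $y=\overline W\bar z$ with some $\bar z$ such that $$\min\{\langle y,z-y\rangle \mid z\in\mathbb{R}^m,\ W\in\mathcal J,\ y=Wz\}=\langle y,\bar z-y\rangle .$$ Then, for every $U\in\mathcal J$ and every $\sigma>0$, the matrix $I+(\sigma-1)U$ is invertible, and the following hold. 1. For every $\sigma>0$, every $d\in\mathbb{R}^m$, every $z\in D^*\operatorname{Prox}_{\sigma r^*}(\bar u+\sigma\bar x)(d)$, and every $U\in\mathcal J$ with $z=(I+(\sigma-1)U)^{-1}(I-U)d$, $$\|z\|^2\ \ge\ \|(I-UU^\dagger)d\|^2\ \ge\ \|(I-\overline W\,\overline W^\dagger)d\|^2 .$$ 2. For every (fixed) $U\in\mathcal J$ and $d\in\mathbb{R}^m$, $$\big\|\sigma(I+(\sigma-1)U)^{-1}Ud-UU^\dagger d\big\|\to 0\quad\text{as }\sigma\to\infty .$$ -/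

import Mathlib

open Filter Topology

noncomputable section

namespace ProxVar

/-- The Euclidean space `ℝᵐ`. -/
abbrev E (m : ℕ) : Type := EuclideanSpace ℝ (Fin m)

/-- Square real matrices of size `m`. -/
abbrev Mat (m : ℕ) : Type := Matrix (Fin m) (Fin m) ℝ

/-- The product `A x` of a matrix and a vector of the Euclidean space. -/
def app {m : ℕ} (A : Mat m) (x : E m) : E m := WithLp.toLp 2 (A.mulVec x.ofLp)

/-- The range of (the linear map given by) a matrix. -/
def rge {m : ℕ} (A : Mat m) : Set (E m) := Set.range (app A)

/-! ### Extended-real-valued functions -/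

/-- The effective domain. -/
def effDom {m : ℕ} (r : E m → EReal) : Set (E m) := {x | r x < ⊤}

/-- The epigraph, as a subset of `ℝᵐ × ℝ`. -/
def epigraph {m : ℕ} (r : E m → EReal) : Set (E m × ℝ) := {p | r p.1 ≤ (p.2 : EReal)}

/-- Convexity of an extended-real-valued function: its epigraph is convex. -/
def ConvexFun {m : ℕ} (r : E m → EReal) : Prop := Convex ℝ (epigraph r)

/-- The Fenchel conjugate `r*(x) = sup {⟨x, u⟩ - r u | u ∈ dom r}`. -/
def conj {m : ℕ} (r : E m → EReal) (x : E m) : EReal :=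
  ⨆ u ∈ effDom r, (((inner ℝ x u : ℝ) : EReal) - r u)

/-- The regular (Fréchet) subdifferential: `y` such that
`r x' ≥ r x + ⟨y, x' - x⟩ + o(‖x' - x‖)`, at points `x` of the effective domain. -/
def regularSubdiff {m : ℕ} (r : E m → EReal) (x : E m) : Set (E m) :=
  {y | x ∈ effDom r ∧ ∀ ε : ℝ, 0 < ε → ∀ᶠ x' in 𝓝 x,
    r x + ((inner ℝ y (x' - x) - ε * ‖x' - x‖ : ℝ) : EReal) ≤ r x'}

/-- The limiting (Mordukhovich) subdifferential, at points `x` of the effective domain. -/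
def limitingSubdiff {m : ℕ} (r : E m → EReal) (x : E m) : Set (E m) :=
  {y | x ∈ effDom r ∧ ∃ (xs ys : ℕ → E m),
    Tendsto xs atTop (𝓝 x) ∧ Tendsto (fun k => r (xs k)) atTop (𝓝 (r x)) ∧
    (∀ k, ys k ∈ regularSubdiff r (xs k)) ∧ Tendsto ys atTop (𝓝 y)}

/-! ### The proximal mapping -/

/-- The proximal mapping `Prox_{σ r}` as a multifunction:
`Prox_{σ r}(x) = argmin_u {r u + ‖u - x‖² / (2 σ)}`. -/
def proxSet {m : ℕ} (σ : ℝ) (r : E m → EReal) (x : E m) : Set (E m) :=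
  {u | ∀ v : E m, r u + ((1 / (2 * σ) * ‖u - x‖ ^ 2 : ℝ) : EReal) ≤
    r v + ((1 / (2 * σ) * ‖v - x‖ ^ 2 : ℝ) : EReal)}

/-- The proximal mapping as a single-valued mapping: the element of `proxSet σ r x`, which
exists and is unique for `σ > 0` and `r` proper, lower semicontinuous and convex. -/
def prox {m : ℕ} (σ : ℝ) (r : E m → EReal) (x : E m) : E m :=
  Classical.epsilon fun u => u ∈ proxSet σ r x

/-! ### Generalized Jacobians -/

/-- The Jacobian matrix of `S` at `x` (used at points of differentiability only). -/
def jacobian {m : ℕ} (S : E m → E m) (x : E m) : Mat m :=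
  Matrix.of fun i j => (fderiv ℝ S x (EuclideanSpace.single j (1 : ℝ))) i

/-- The limiting Jacobian: limits of Jacobian matrices `S'(xₖ)` along sequences `xₖ → x` of
points of differentiability. -/
def limitingJacobian {m : ℕ} (S : E m → E m) (x : E m) : Set (Mat m) :=
  {V | ∃ xs : ℕ → E m, (∀ k, DifferentiableAt ℝ S (xs k)) ∧ Tendsto xs atTop (𝓝 x) ∧
    Tendsto (fun k => jacobian S (xs k)) atTop (𝓝 V)}

/-- The Clarke generalized Jacobian: the convex hull of the limiting Jacobian. -/
def clarkeJacobian {m : ℕ} (S : E m → E m) (x : E m) : Set (Mat m) :=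
  convexHull ℝ (limitingJacobian S x)

/-! ### Normal cones and coderivatives -/

/-- The regular (Fréchet) normal cone to `C` at `x ∈ C`: those `y` with
`limsup ⟨y, x' - x⟩ / ‖x' - x‖ ≤ 0` as `x' → x`, `x' ∈ C`, `x' ≠ x`. -/
def regularNormalCone {F : Type*} [NormedAddCommGroup F] [InnerProductSpace ℝ F]
    (C : Set F) (x : F) : Set F :=
  {y | x ∈ C ∧ ∀ ε : ℝ, 0 < ε → ∀ᶠ x' in 𝓝[C] x, inner ℝ y (x' - x) ≤ ε * ‖x' - x‖}

/-- The limiting (Mordukhovich) normal cone to `C` at `x ∈ C`. -/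
def limitingNormalCone {F : Type*} [NormedAddCommGroup F] [InnerProductSpace ℝ F]
    (C : Set F) (x : F) : Set F :=
  {y | x ∈ C ∧ ∃ (xs ys : ℕ → F), (∀ k, xs k ∈ C) ∧ Tendsto xs atTop (𝓝 x) ∧
    (∀ k, ys k ∈ regularNormalCone C (xs k)) ∧ Tendsto ys atTop (𝓝 y)}

/-- The graph of a multifunction, in `ℝᵐ × ℝᵐ` with its Euclidean structure. -/
def gph {m : ℕ} (S : E m → Set (E m)) : Set (WithLp 2 (E m × E m)) :=
  {p | p.snd ∈ S p.fst}

/-- The limiting coderivative `D*S(x, u)(w)` of the multifunction `S` at `x` for `u ∈ S x`: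
`z ∈ D*S(x, u)(w)` iff `(z, -w)` is a limiting normal to the graph of `S` at `(x, u)`. -/
def limitingCoderivative {m : ℕ} (S : E m → Set (E m)) (x u w : E m) : Set (E m) :=
  {z | WithLp.toLp 2 (z, -w) ∈ limitingNormalCone (gph S) (WithLp.toLp 2 (x, u))}

/-! ### The Moore–Penrose inverse -/

/-- The four Penrose equations. -/
structure IsMoorePenrose {m : ℕ} (A B : Mat m) : Prop where
  mul_mul_left : A * B * A = A
  mul_mul_right : B * A * B = B
  symm_left : (A * B).transpose = A * B
  symm_right : (B * A).transpose = B * A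

theorem exists_isMoorePenrose {m : ℕ} (A : Mat m) : ∃ B, IsMoorePenrose A B := by
  obtain ⟨G, hGt, hMGM, hGMG, hGM⟩ : ∃ G : Mat m, G.transpose = G ∧
      (A.transpose * A) * G * (A.transpose * A) = A.transpose * A ∧
      G * (A.transpose * A) * G = G ∧
      (G * (A.transpose * A)).transpose = G * (A.transpose * A) := by
    have hM : (A.transpose * A).IsHermitian := by
      simpa [Matrix.conjTranspose_eq_transpose_of_trivial] using
        Matrix.isHermitian_conjTranspose_mul_self A
    set P : Mat m := (hM.eigenvectorUnitary : Mat m)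
    have hPP : P.transpose * P = 1 := by
      have := Unitary.coe_star_mul_self hM.eigenvectorUnitary
      simpa [Matrix.star_eq_conjTranspose, Matrix.conjTranspose_eq_transpose_of_trivial] using this
    have hs : A.transpose * A = P * Matrix.diagonal hM.eigenvalues * P.transpose := by
      have := hM.spectral_theorem
      rw [Unitary.conjStarAlgAut_apply] at this
      simpa [Matrix.star_eq_conjTranspose, Matrix.conjTranspose_eq_transpose_of_trivial,
        Function.comp_def] using this
    clear_value P
    generalize hM.eigenvalues = l at hs
    have key : ∀ a b : Fin m → ℝ, (P * Matrix.diagonal a * P.transpose) *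
        (P * Matrix.diagonal b * P.transpose) =
        P * Matrix.diagonal (fun i => a i * b i) * P.transpose := by
      intro a b
      calc _ = P * Matrix.diagonal a * (P.transpose * P) * Matrix.diagonal b * P.transpose := by
            simp only [Matrix.mul_assoc]
        _ = _ := by
            rw [hPP, Matrix.mul_one, Matrix.mul_assoc P, Matrix.diagonal_mul_diagonal]
    have hT : ∀ a : Fin m → ℝ, (P * Matrix.diagonal a * P.transpose).transpose =
        P * Matrix.diagonal a * P.transpose := by
      intro a
      simp [Matrix.transpose_mul, Matrix.mul_assoc]
    refine ⟨P * Matrix.diagonal (fun i => (l i)⁻¹) * P.transpose, hT _, ?_, ?_, ?_⟩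
    · rw [hs, key, key]
      simp [mul_inv_mul_cancel]
    · rw [hs, key, key]
      congr 3
      funext i
      by_cases h : l i = 0 <;> simp [h]
    · rw [hs, key, hT]
  refine ⟨G * A.transpose, ?_, ?_, ?_, ?_⟩
  · have h : A * (G * (A.transpose * A) - 1) = 0 := by
      rw [← Matrix.conjTranspose_mul_self_eq_zero,
        Matrix.conjTranspose_eq_transpose_of_trivial, Matrix.transpose_mul,
        Matrix.transpose_sub, hGM, Matrix.transpose_one]
      calc _ = (G * (A.transpose * A) - 1) *
            ((A.transpose * A) * G * (A.transpose * A) - A.transpose * A) := by noncomm_ring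
        _ = 0 := by rw [hMGM, sub_self, Matrix.mul_zero]
    rw [Matrix.mul_sub, Matrix.mul_one, sub_eq_zero] at h
    simpa only [Matrix.mul_assoc] using h
  · calc G * A.transpose * A * (G * A.transpose) = (G * (A.transpose * A) * G) * A.transpose := by
          simp only [Matrix.mul_assoc]
      _ = _ := by rw [hGMG]
  · simp [Matrix.transpose_mul, hGt, Matrix.mul_assoc]
  · simpa only [Matrix.mul_assoc] using hGM

theorem IsMoorePenrose.unique {m : ℕ} {A B C : Mat m} (hB : IsMoorePenrose A B)
    (hC : IsMoorePenrose A C) : B = C := by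
  have h1 : A * B = A * C := by
    calc A * B = (A * C * A) * B := by rw [hC.mul_mul_left]
      _ = (A * C) * (A * B) := by simp only [Matrix.mul_assoc]
      _ = ((A * B) * (A * C)).transpose := by
          rw [Matrix.transpose_mul, hB.symm_left, hC.symm_left]
      _ = ((A * B * A) * C).transpose := by simp only [Matrix.mul_assoc]
      _ = A * C := by rw [hB.mul_mul_left, hC.symm_left]
  have h2 : B * A = C * A := by
    calc B * A = B * (A * C * A) := by rw [hC.mul_mul_left]
      _ = (B * A) * (C * A) := by simp only [Matrix.mul_assoc]
      _ = ((C * A) * (B * A)).transpose := by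
          rw [Matrix.transpose_mul, hB.symm_right, hC.symm_right]
      _ = (C * (A * B * A)).transpose := by simp only [Matrix.mul_assoc]
      _ = C * A := by rw [hB.mul_mul_left, hC.symm_right]
  calc B = B * A * B := hB.mul_mul_right.symm
    _ = C * (A * B) := by rw [h2, Matrix.mul_assoc]
    _ = C * A * C := by rw [h1, Matrix.mul_assoc]
    _ = C := hC.mul_mul_right

/-- The Moore–Penrose inverse of a square real matrix. -/
def pinv {m : ℕ} (A : Mat m) : Mat m := Classical.choose (exists_isMoorePenrose A)

/-! ### The structural assumption -/

/-- The union of the ranges of all matrices of the Clarke Jacobian of `Prox_r` at `x + u`. -/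
def rangeUnion {m : ℕ} (r : E m → EReal) (x u : E m) : Set (E m) :=
  ⋃ W ∈ clarkeJacobian (prox 1 r) (x + u), rge W

/-- The matrix `Wbar` of the limiting Jacobian of `Prox_r` at `x + u` represents the union of the
ranges of all the matrices `W` of the Clarke Jacobian, and each `y` in that union is `Wbar zbar`
for some `zbar` at which the minimum of `⟨y, z - y⟩`, over all `z` and all `W` of the Clarke
Jacobian with `y = W z`, is attained. -/
structure RangeAssumption {m : ℕ} (r : E m → EReal) (x u : E m) (Wbar : Mat m) : Prop where
  mem_limitingJacobian : Wbar ∈ limitingJacobian (prox 1 r) (x + u)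
  range_eq : rangeUnion r x u = rge Wbar
  min_attained : ∀ y ∈ rangeUnion r x u, ∃ zbar : E m, y = app Wbar zbar ∧
    IsLeast {t : ℝ | ∃ z : E m, ∃ W ∈ clarkeJacobian (prox 1 r) (x + u),
      y = app W z ∧ t = inner ℝ y (z - y)} (inner ℝ y (zbar - y))

end ProxVar

end

open ProxVar

namespace ProxVar

variable {m : ℕ}

/-! ### Matrices acting on the Euclidean space -/

/-! Everything rests on firm nonexpansiveness of `prox 1 r`. That property passes to Jacobians, to
their limits and to convex combinations, so every `U` in the Clarke Jacobian satisfies `FirmMat`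
(`firm_prox`, `firmMat_of_mem_clarkeJacobian`); the rest is linear algebra for such `U`. Solving `(I
+ (σ-1)U) z = (I - U) d` as `z = d - U(d + (σ-1) z)` shows that `z` differs from `d` by an element
of `rge U`, so `‖z‖` is at least the distance from `d` to `rge U`, which is `‖(I - UU†) d‖`. The
bound with `Wbar` holds because `rge U` lies in `rge Wbar`. For the limit, `U` vanishes on the
orthogonal complement of `rge U`, hence `U` maps `d` and `UU†d` to the same vector. The difference
then equals `(I + (σ-1)U)⁻¹ U g` with `g = d - U†d`, which is at most `‖g‖ / σ`. -/

theorem app_vec_add (A : Mat m) (x y : E m) : app A (x + y) = app A x + app A y := by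
  simp [app, Matrix.mulVec_add]

theorem app_vec_sub (A : Mat m) (x y : E m) : app A (x - y) = app A x - app A y := by
  simp [app, Matrix.mulVec_sub]

theorem app_vec_smul (A : Mat m) (c : ℝ) (x : E m) : app A (c • x) = c • app A x := by
  simp [app, Matrix.mulVec_smul]

theorem app_add (A B : Mat m) (x : E m) : app (A + B) x = app A x + app B x := by
  simp [app, Matrix.add_mulVec]

theorem app_sub (A B : Mat m) (x : E m) : app (A - B) x = app A x - app B x := by
  simp [app, Matrix.sub_mulVec]

theorem app_smul (c : ℝ) (A : Mat m) (x : E m) : app (c • A) x = c • app A x := by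
  simp [app, Matrix.smul_mulVec]

theorem app_mul (A B : Mat m) (x : E m) : app (A * B) x = app A (app B x) := by
  simp [app, Matrix.mulVec_mulVec]

theorem app_one (x : E m) : app 1 x = x := by
  simp [app]

theorem app_zero (x : E m) : app (0 : Mat m) x = 0 := by
  simp [app]

theorem inner_app_left (A : Mat m) (x y : E m) :
    inner ℝ (app A x) y = inner ℝ x (app A.transpose y) := by
  simp only [app, EuclideanSpace.inner_eq_star_dotProduct, star_trivial]
  rw [Matrix.dotProduct_mulVec, Matrix.mulVec_transpose, dotProduct_comm]

theorem continuous_app (x : E m) : Continuous fun A : Mat m => app A x := by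
  unfold app
  exact (PiLp.continuous_toLp 2 _).comp (Continuous.matrix_mulVec continuous_id continuous_const)

theorem app_jacobian (S : E m → E m) (x d : E m) : app (jacobian S x) d = fderiv ℝ S x d := by
  have hd : d = ∑ j, d j • EuclideanSpace.single j (1 : ℝ) := by
    ext i
    simp [Finset.sum_apply, Pi.single_apply]
  conv_rhs => rw [hd]
  ext i
  simp [app, jacobian, Matrix.mulVec, dotProduct, mul_comm]

/-! ### The projection onto the orthogonal complement of the range -/

theorem isMoorePenrose_pinv (A : Mat m) : IsMoorePenrose A (pinv A) :=
  Classical.choose_spec (exists_isMoorePenrose A)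

theorem app_one_sub_mul_pinv_app (A : Mat m) (x : E m) :
    app (1 - A * pinv A) (app A x) = 0 := by
  rw [← app_mul, sub_mul, one_mul, (isMoorePenrose_pinv A).mul_mul_left, sub_self, app_zero]

/-- Since `A A†` is symmetric, `I - A A†` can be moved onto `A x`, which it annihilates. -/
theorem inner_app_one_sub_mul_pinv (A : Mat m) (d x : E m) :
    inner ℝ (app (1 - A * pinv A) d) (app A x) = 0 := by
  rw [inner_app_left, Matrix.transpose_sub, Matrix.transpose_one,
    (isMoorePenrose_pinv A).symm_left, app_one_sub_mul_pinv_app, inner_zero_right]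

/-- The residual of the projection onto `rge A` is the distance to `rge A`. -/
theorem norm_app_one_sub_mul_pinv_le (A : Mat m) (d x : E m) :
    ‖app (1 - A * pinv A) d‖ ^ 2 ≤ ‖d - app A x‖ ^ 2 := by
  have h : d - app A x = app (1 - A * pinv A) d + app A (app (pinv A) d - x) := by
    rw [app_vec_sub, app_sub, app_one, app_mul]
    abel
  rw [h, norm_add_sq_real, inner_app_one_sub_mul_pinv]
  nlinarith [sq_nonneg ‖app A (app (pinv A) d - x)‖]

theorem norm_residual_le_of_rge_subset {A B : Mat m} (h : rge A ⊆ rge B) (d : E m) :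
    ‖app (1 - B * pinv B) d‖ ^ 2 ≤ ‖app (1 - A * pinv A) d‖ ^ 2 := by
  obtain ⟨x, hx⟩ := h ⟨app (pinv A) d, rfl⟩
  have := norm_app_one_sub_mul_pinv_le B d x
  rw [hx, ← app_mul] at this
  rwa [app_sub 1 (A * pinv A), app_one]

/-! ### Firmly nonexpansive matrices -/

/-- The matrices `U` with `‖U d‖² ≤ ⟨U d, d⟩` for all `d`. -/
def FirmMat (U : Mat m) : Prop := ∀ d : E m, ‖app U d‖ ^ 2 ≤ inner ℝ (app U d) d

theorem isClosed_firmMat : IsClosed {U : Mat m | FirmMat U} := by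
  simp only [FirmMat, Set.ofPred_forall]
  exact isClosed_iInter fun d => isClosed_le ((continuous_app d).norm.pow 2)
    ((continuous_app d).inner continuous_const)

theorem convex_firmMat : Convex ℝ {U : Mat m | FirmMat U} := by
  intro A hA B hB a b ha hb hab d
  have h1 := hA d
  have h2 := hB d
  rw [app_add, app_smul, app_smul, inner_add_left, real_inner_smul_left, real_inner_smul_left]
  -- The squared norm is convex in the matrix, while the other side of the inequality is linear in
  -- it.
  have h3 : ‖a • app A d + b • app B d‖ ^ 2 ≤ a * ‖app A d‖ ^ 2 + b * ‖app B d‖ ^ 2 :=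
    ((convexOn_univ_norm (E := E m)).pow (fun _ _ => norm_nonneg _) 2).2 trivial trivial ha hb hab
  nlinarith

theorem FirmMat.isUnit {U : Mat m} (hU : FirmMat U) {σ : ℝ} (hσ : 0 < σ) :
    IsUnit (1 + (σ - 1) • U) := by
  rw [← Matrix.mulVec_injective_iff_isUnit]
  refine (injective_iff_map_eq_zero (Matrix.mulVecLin (1 + (σ - 1) • U))).2 fun v hv => ?_
  set w : E m := WithLp.toLp 2 v with hw
  have h0 : app (1 + (σ - 1) • U) w = 0 := by
    have : (1 + (σ - 1) • U).mulVec v = 0 := hv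
    simp [app, hw, this]
  rw [app_add, app_one, app_smul] at h0
  have h1 := hU w
  -- Pairing the kernel equation with `U w` and using firmness gives `σ ‖U w‖² ≤ 0`.
  have h2 : inner ℝ (app U w) (w + (σ - 1) • app U w) = 0 := by rw [h0, inner_zero_right]
  rw [inner_add_right, real_inner_smul_right, real_inner_self_eq_norm_sq] at h2
  have h3 : ‖app U w‖ ^ 2 = 0 := by nlinarith [sq_nonneg ‖app U w‖]
  have h4 : app U w = 0 := by simpa using h3
  rw [h4, smul_zero, add_zero] at h0
  simpa [hw] using h0

/-- The kernel of a monotone matrix contains the orthogonal complement of its range. -/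
theorem FirmMat.app_eq_zero_of_orthogonal {U : Mat m} (hU : FirmMat U) {v : E m}
    (hv : ∀ w, inner ℝ v (app U w) = 0) : app U v = 0 := by
  have h := hU v
  rw [real_inner_comm, hv v] at h
  have : ‖app U v‖ ^ 2 = 0 := le_antisymm h (sq_nonneg _)
  simpa using this

theorem FirmMat.app_inv_eq {U : Mat m} (hU : FirmMat U) {σ : ℝ} (hσ : 0 < σ) {x y : E m}
    (h : app (1 + (σ - 1) • U) x = y) : app (1 + (σ - 1) • U)⁻¹ y = x := by
  rw [← h, ← app_mul, Matrix.nonsing_inv_mul _ ((Matrix.isUnit_iff_isUnit_det _).1 (hU.isUnit hσ)),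
    app_one]

theorem FirmMat.app_app_inv {U : Mat m} (hU : FirmMat U) {σ : ℝ} (hσ : 0 < σ) (x : E m) :
    app (1 + (σ - 1) • U) (app (1 + (σ - 1) • U)⁻¹ x) = x := by
  rw [← app_mul, Matrix.mul_nonsing_inv _ ((Matrix.isUnit_iff_isUnit_det _).1 (hU.isUnit hσ)),
    app_one]

theorem FirmMat.norm_residual_le {U : Mat m} (hU : FirmMat U) {σ : ℝ} (hσ : 0 < σ) (d : E m) :
    ‖app (1 - U * pinv U) d‖ ^ 2 ≤ ‖app ((1 + (σ - 1) • U)⁻¹ * (1 - U)) d‖ ^ 2 := by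
  rw [app_mul]
  have h := hU.app_app_inv hσ (app (1 - U) d)
  set z := app (1 + (σ - 1) • U)⁻¹ (app (1 - U) d)
  rw [app_add, app_one, app_smul, app_sub, app_one] at h
  have hz : z = d - app U (d + (σ - 1) • z) := by
    rw [app_vec_add, app_vec_smul, ← sub_sub, ← h, add_sub_cancel_right]
  rw [hz]
  exact norm_app_one_sub_mul_pinv_le U d _

theorem FirmMat.norm_app_inv_app_le {U : Mat m} (hU : FirmMat U) {σ : ℝ} (hσ : 0 < σ) (g : E m) :
    ‖app (1 + (σ - 1) • U)⁻¹ (app U g)‖ ≤ ‖g‖ / σ := by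
  have h := hU.app_app_inv hσ (app U g)
  set q := app (1 + (σ - 1) • U)⁻¹ (app U g)
  rw [app_add, app_one, app_smul] at h
  have hq : app U (g - (σ - 1) • q) = q := by
    rw [app_vec_sub, app_vec_smul, ← h, add_sub_cancel_right]
  -- As `q` is the image of this vector, firmness yields `σ ‖q‖² ≤ ⟨q, g⟩`.
  have h1 := hU (g - (σ - 1) • q)
  rw [hq, inner_sub_right, real_inner_smul_right, real_inner_self_eq_norm_sq] at h1
  have h2 := real_inner_le_norm q g
  rw [le_div_iff₀ hσ]
  rcases (norm_nonneg q).eq_or_lt with h0 | h0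
  · rw [← h0, zero_mul]
    exact norm_nonneg g
  · refine le_of_mul_le_mul_left ?_ h0
    nlinarith

theorem FirmMat.tendsto {U : Mat m} (hU : FirmMat U) (d : E m) :
    Tendsto (fun σ : ℝ => ‖σ • app ((1 + (σ - 1) • U)⁻¹ * U) d - app (U * pinv U) d‖)
      atTop (𝓝 0) := by
  set p := app (U * pinv U) d with hp
  have hUp : app U p = app U d := by
    have : app U (app (1 - U * pinv U) d) = 0 :=
      hU.app_eq_zero_of_orthogonal (inner_app_one_sub_mul_pinv U d)
    rw [app_sub, app_one, app_vec_sub, sub_eq_zero] at this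
    exact this.symm
  set g := d - app (pinv U) d
  have hg : app U g = app U d - p := by rw [app_vec_sub, hp, app_mul]
  refine squeeze_zero' (Eventually.of_forall fun _ => norm_nonneg _) ?_
    (tendsto_const_nhds.div_atTop tendsto_id : Tendsto (fun σ : ℝ => ‖g‖ / σ) atTop (𝓝 0))
  filter_upwards [eventually_gt_atTop 0] with σ hσ
  refine le_of_eq_of_le ?_ (hU.norm_app_inv_app_le hσ g)
  congr 1
  -- Applying `I + (σ-1)U` to the difference leaves `U d - p = U g`, because `U p = U d`.
  refine (hU.app_inv_eq hσ ?_).symm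
  rw [app_vec_sub, app_vec_smul, app_mul, hU.app_app_inv hσ, hg, app_add, app_one, app_smul, hUp,
    sub_smul, one_smul]
  abel

/-! ### Convex functions -/

theorem ConvexFun.le_coe_combo {r : E m → EReal} (hr : ConvexFun r) {x y : E m} {a b : ℝ}
    (hx : r x ≤ a) (hy : r y ≤ b) {t : ℝ} (h0 : 0 ≤ t) (h1 : t ≤ 1) :
    r (x + t • (y - x)) ≤ ((a + t * (b - a) : ℝ) : EReal) := by
  have := hr (x := (x, a)) hx (y := (y, b)) hy (sub_nonneg.2 h1) h0 (sub_add_cancel 1 t)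
  simp only [epigraph, Set.mem_ofPred_eq, Prod.smul_mk, Prod.mk_add_mk, smul_eq_mul] at this
  convert this using 2
  · module
  · ring_nf

theorem exists_coe_eq {r : E m → EReal} (hr_bot : ∀ x, r x ≠ ⊥) {x : E m} (hx : x ∈ effDom r) :
    ∃ a : ℝ, r x = a :=
  ⟨(r x).toReal, (EReal.coe_toReal (ne_of_lt hx) (hr_bot x)).symm⟩

/-- Near a point with a regular subgradient, a convex function lies above a concave function of
linear growth; hence it does so everywhere. -/
theorem ConvexFun.lower_bound {r : E m → EReal} (hr_bot : ∀ x, r x ≠ ⊥) (hr : ConvexFun r)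
    {x y : E m} (hy : y ∈ regularSubdiff r x) {a : ℝ} (ha : r x = a) (v : E m) :
    ((a - (‖y‖ + 1) * ‖v - x‖ : ℝ) : EReal) ≤ r v := by
  rcases eq_or_ne (r v) ⊤ with htop | htop
  · rw [htop]; exact le_top
  obtain ⟨b, hb⟩ := exists_coe_eq hr_bot (lt_top_iff_ne_top.2 htop)
  -- The local estimate with `ε = 1` is used at a point of the segment near `x`, and convexity
  -- carries it to `v`.
  have hlim : Tendsto (fun t : ℝ => x + t • (v - x)) (𝓝[>] 0) (𝓝 x) := by
    have : Continuous fun t : ℝ => x + t • (v - x) := by fun_prop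
    simpa using (this.tendsto 0).mono_left nhdsWithin_le_nhds
  have hlt : ∀ᶠ t : ℝ in 𝓝[>] 0, t < 1 := nhdsWithin_le_nhds (eventually_lt_nhds one_pos)
  obtain ⟨t, ht, ht1, ht0⟩ := ((hlim.eventually (hy.2 1 one_pos)).and
    (hlt.and self_mem_nhdsWithin)).exists
  have ht0 : 0 < t := ht0
  have h := ht.trans (hr.le_coe_combo ha.le hb.le ht0.le ht1.le)
  rw [ha, ← EReal.coe_add, EReal.coe_le_coe_iff, add_sub_cancel_left, norm_smul,
    real_inner_smul_right, Real.norm_of_nonneg ht0.le] at h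
  rw [hb, EReal.coe_le_coe_iff]
  have h2 := (abs_le.1 (abs_real_inner_le_norm y (v - x))).1
  refine le_of_mul_le_mul_left ?_ ht0
  nlinarith

/-! ### The proximal mapping -/

theorem proxSet_nonempty {r : E m → EReal}
    (hr_lsc : LowerSemicontinuous r) {x₀ : E m} {a L : ℝ} (ha : r x₀ = a)
    (hbound : ∀ v, ((a - L * ‖v - x₀‖ : ℝ) : EReal) ≤ r v) (hL : 0 ≤ L) (x : E m) :
    (proxSet 1 r x).Nonempty := by
  set q : E m → ℝ := fun v => 1 / (2 * 1) * ‖v - x‖ ^ 2 with hq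
  have hqc : Continuous q := by fun_prop
  have hf : LowerSemicontinuous fun v => r v + ((q v : ℝ) : EReal) := by
    refine LowerSemicontinuous.add' hr_lsc
      (continuous_coe_real_ereal.comp hqc).lowerSemicontinuous fun v => ?_
    exact EReal.continuousAt_add (Or.inr (EReal.coe_ne_bot _)) (Or.inr (EReal.coe_ne_top _))
  -- Beyond this radius `½‖v - x‖² - ½‖x₀ - x‖²` outweighs `L (‖v - x‖ + ‖x₀ - x‖)`, so no such `v`
  -- beats `x₀`.
  set ρ : ℝ := ‖x₀ - x‖ + 2 * L with hρ
  have hmem : x₀ ∈ Metric.closedBall x ρ := by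
    rw [Metric.mem_closedBall, dist_eq_norm, hρ]; linarith
  obtain ⟨u, -, hu⟩ := (hf.lowerSemicontinuousOn _).exists_isMinOn ⟨x₀, hmem⟩
    (isCompact_closedBall x ρ)
  refine ⟨u, fun v => ?_⟩
  by_cases hv : v ∈ Metric.closedBall x ρ
  · exact hu hv
  refine (hu hmem).trans ?_
  refine le_trans ?_ (add_le_add_left (hbound v) _)
  simp only [ha, hq, ← EReal.coe_add, EReal.coe_le_coe_iff]
  rw [Metric.mem_closedBall, dist_eq_norm, not_le, hρ] at hv
  have h3 : ‖v - x₀‖ ≤ ‖v - x‖ + ‖x₀ - x‖ := by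
    simpa using norm_sub_le (v - x) (x₀ - x)
  nlinarith [norm_nonneg (x₀ - x), norm_nonneg (v - x), mul_le_mul_of_nonneg_left h3 hL]

theorem prox_mem {r : E m → EReal} {x : E m} (h : (proxSet 1 r x).Nonempty) :
    prox 1 r x ∈ proxSet 1 r x :=
  Classical.epsilon_spec h

theorem mem_effDom_of_mem_proxSet {r : E m → EReal} {x₀ x p : E m} (hx₀ : x₀ ∈ effDom r)
    (hp : p ∈ proxSet 1 r x) : p ∈ effDom r := by
  have h := (hp x₀).trans_lt
    (EReal.add_lt_top (LT.lt.ne (b := (⊤ : EReal)) hx₀) (EReal.coe_ne_top _))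
  refine (lt_top_iff_ne_top (a := r p)).2 fun htop => ?_
  rw [htop, EReal.top_add_coe] at h
  exact lt_irrefl _ h

/-- This is the optimality condition `x - p ∈ ∂r(p)`: compare `p` with `p + t(q - p)`, divide by `t`
and let `t` decrease to 0. -/
theorem le_add_inner_of_mem_proxSet {r : E m → EReal} (hr : ConvexFun r) {x p q : E m}
    (hp : p ∈ proxSet 1 r x) {a b : ℝ} (ha : r p = a) (hb : r q = b) :
    a ≤ b + inner ℝ (q - p) (p - x) := by
  have key : ∀ t : ℝ, 0 < t → t < 1 →
      a ≤ b + inner ℝ (q - p) (p - x) + t * (‖q - p‖ ^ 2 / 2) := by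
    intro t ht0 ht1
    have h := (hp (p + t • (q - p))).trans
      (add_le_add_left (hr.le_coe_combo ha.le hb.le ht0.le ht1.le) _)
    rw [ha, ← EReal.coe_add, ← EReal.coe_add, EReal.coe_le_coe_iff,
      show p + t • (q - p) - x = (p - x) + t • (q - p) by abel, norm_add_sq_real, norm_smul,
      real_inner_smul_right, Real.norm_of_nonneg ht0.le, real_inner_comm] at h
    refine le_of_mul_le_mul_left ?_ ht0
    nlinarith
  have hc : Tendsto (fun t : ℝ => b + inner ℝ (q - p) (p - x) + t * (‖q - p‖ ^ 2 / 2)) (𝓝[>] 0)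
      (𝓝 (b + inner ℝ (q - p) (p - x))) := by
    have : Continuous fun t : ℝ => b + inner ℝ (q - p) (p - x) + t * (‖q - p‖ ^ 2 / 2) := by
      fun_prop
    simpa using (this.tendsto 0).mono_left nhdsWithin_le_nhds
  have hlt : ∀ᶠ t : ℝ in 𝓝[>] 0, t < 1 := nhdsWithin_le_nhds (eventually_lt_nhds one_pos)
  refine ge_of_tendsto hc ?_
  filter_upwards [hlt, self_mem_nhdsWithin] with t ht1 ht0 using key t ht0 ht1

/-- Adding the optimality conditions at `p` and `q` cancels the values of `r`. -/
theorem firm_of_mem_proxSet {r : E m → EReal} (hr_bot : ∀ x, r x ≠ ⊥) (hr : ConvexFun r)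
    {x₀ x y p q : E m} (hx₀ : x₀ ∈ effDom r) (hp : p ∈ proxSet 1 r x) (hq : q ∈ proxSet 1 r y) :
    ‖q - p‖ ^ 2 ≤ inner ℝ (q - p) (y - x) := by
  obtain ⟨a, ha⟩ := exists_coe_eq hr_bot (mem_effDom_of_mem_proxSet hx₀ hp)
  obtain ⟨b, hb⟩ := exists_coe_eq hr_bot (mem_effDom_of_mem_proxSet hx₀ hq)
  have h1 := le_add_inner_of_mem_proxSet hr hp ha hb
  have h2 := le_add_inner_of_mem_proxSet hr hq hb ha
  have h3 : inner ℝ (p - q) (q - y) = - inner ℝ (q - p) (q - y) := by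
    rw [← inner_neg_left, neg_sub]
  have h4 : p - x = (q - y) + (y - x) - (q - p) := by abel
  rw [h4, inner_sub_right, inner_add_right, real_inner_self_eq_norm_sq] at h1
  linarith

/-! ### Generalized Jacobians of firmly nonexpansive mappings -/

theorem firmMat_jacobian {S : E m → E m}
    (hS : ∀ x y, ‖S y - S x‖ ^ 2 ≤ inner ℝ (S y - S x) (y - x)) {x : E m}
    (hx : DifferentiableAt ℝ S x) : FirmMat (jacobian S x) := by
  intro d
  rw [app_jacobian]
  -- Firmness between `x` and `x + t d`, divided by `t²`, passes to the limit of difference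
  -- quotients.
  have h := (hx.hasFDerivAt.hasLineDerivAt d).tendsto_slope_zero_right
  refine le_of_tendsto_of_tendsto (h.norm.pow 2) (h.inner tendsto_const_nhds) ?_
  filter_upwards [self_mem_nhdsWithin] with t ht
  have ht : 0 < t := ht
  have h1 := hS x (x + t • d)
  rw [add_sub_cancel_left, real_inner_smul_right] at h1
  rw [norm_smul, real_inner_smul_left, mul_pow, norm_inv, Real.norm_of_nonneg ht.le]
  calc t⁻¹ ^ 2 * ‖S (x + t • d) - S x‖ ^ 2
      ≤ t⁻¹ ^ 2 * (t * inner ℝ (S (x + t • d) - S x) d) := by gcongr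
    _ = t⁻¹ * inner ℝ (S (x + t • d) - S x) d := by field_simp

theorem firmMat_of_mem_clarkeJacobian {S : E m → E m}
    (hS : ∀ x y, ‖S y - S x‖ ^ 2 ≤ inner ℝ (S y - S x) (y - x)) {x : E m} {U : Mat m}
    (hU : U ∈ clarkeJacobian S x) : FirmMat U := by
  refine convexHull_min (t := {U : Mat m | FirmMat U}) ?_ convex_firmMat hU
  rintro V ⟨xs, hd, -, hV⟩
  exact isClosed_firmMat.mem_of_tendsto hV (Eventually.of_forall fun k => firmMat_jacobian hS (hd k))

theorem firm_prox {r : E m → EReal} (hr_bot : ∀ x, r x ≠ ⊥) (hr_lsc : LowerSemicontinuous r)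
    (hr : ConvexFun r) {x₀ y₀ : E m} (hy₀ : y₀ ∈ regularSubdiff r x₀) (x y : E m) :
    ‖prox 1 r y - prox 1 r x‖ ^ 2 ≤ inner ℝ (prox 1 r y - prox 1 r x) (y - x) := by
  obtain ⟨a, ha⟩ := exists_coe_eq hr_bot hy₀.1
  have hne := proxSet_nonempty hr_lsc ha (hr.lower_bound hr_bot hy₀ ha) (by positivity)
  exact firm_of_mem_proxSet hr_bot hr hy₀.1 (prox_mem (hne x)) (prox_mem (hne y))

end ProxVar

theorem mainTheorem2 (m : ℕ) (r : E m → EReal) (hr_bot : ∀ x, r x ≠ ⊥)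
    (hr_lsc : LowerSemicontinuous r) (hr_conv : ConvexFun r)
    (xbar ubar : E m) (hx : xbar ∈ effDom r) (hu : ubar ∈ limitingSubdiff r xbar)
    (Wbar : Mat m) (hW : RangeAssumption r xbar ubar Wbar) :
    -- the inverses in the statement exist
    (∀ U ∈ clarkeJacobian (prox 1 r) (xbar + ubar), ∀ σ : ℝ, 0 < σ →
      IsUnit (1 + (σ - 1) • U)) ∧
    -- the estimates of the norm of elements of the coderivative
    (∀ σ : ℝ, 0 < σ → ∀ d z : E m,
      z ∈ limitingCoderivative (proxSet σ (conj r)) (ubar + σ • xbar)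
        (prox σ (conj r) (ubar + σ • xbar)) d →
      ∀ U ∈ clarkeJacobian (prox 1 r) (xbar + ubar),
        z = app ((1 + (σ - 1) • U)⁻¹ * (1 - U)) d →
        ‖app (1 - U * pinv U) d‖ ^ 2 ≤ ‖z‖ ^ 2 ∧
        ‖app (1 - Wbar * pinv Wbar) d‖ ^ 2 ≤ ‖app (1 - U * pinv U) d‖ ^ 2) ∧
    -- the limit for a fixed matrix as the parameter tends to infinity
    (∀ U ∈ clarkeJacobian (prox 1 r) (xbar + ubar), ∀ d : E m,
      Tendsto (fun σ : ℝ => ‖σ • app ((1 + (σ - 1) • U)⁻¹ * U) d - app (U * pinv U) d‖)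
        atTop (𝓝 0)) := by
  -- A single regular subgradient, here `ys 0` at `xs 0`, gives the lower bound that makes the
  -- proximal problems solvable.
  obtain ⟨-, xs, ys, -, -, hys, -⟩ := hu
  have hfirm : ∀ U ∈ clarkeJacobian (prox 1 r) (xbar + ubar), FirmMat U := fun U hU =>
    firmMat_of_mem_clarkeJacobian (firm_prox hr_bot hr_lsc hr_conv (hys 0)) hU
  refine ⟨fun U hU σ hσ => (hfirm U hU).isUnit hσ, fun σ hσ d z _ U hU hz => ⟨?_, ?_⟩,
    fun U hU d => (hfirm U hU).tendsto d⟩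
  · rw [hz]
    exact (hfirm U hU).norm_residual_le hσ d
  · refine norm_residual_le_of_rge_subset ?_ d
    rw [← hW.range_eq]
    exact Set.subset_biUnion_of_mem hU
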